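/- Let $G=SO(n)\subset\mathbb R^{n\times n}$ with Lie algebra $\mathfrak g=\mathfrak{so}(n)=\{A: A+A^{T}=0\}$, or $G=U(n)\subset\mathbb C^{n\times n}$ with Lie algebra $\mathfrak g=\mathfrak u(n)=\{A: A+A^{*}=0\}$. Equip the space of matrices with the real inner product $\langle X,Y\rangle=\operatorname{Re}\operatorname{tr}(X^{*}Y)$, and give $\mathfrak g$ and the tangent spaces $T_BG=\{X: B^{*}X+X^{*}B=0\}$ the induced inner products. A retraction on $G$ is a family of maps $r_B:T_BG\to G$, $B\in G$, such that for every $B\in G$ one has $r_B(0)=B$, and $r_B$ is differentiable at $0$ with $(\mathrm d r_B)_0=\mathrm{Id}_{T_BG}$. For $A\in\mathfrak g$ let $(\mathrm d\exp)_A:\mathfrak g\to T_{e^A}G$ be the differential of the matrix exponential and $(\mathrm d\exp)_A^{*}$ its adjoint, so that $\nabla(f\circ\exp)(A)=(\mathrm d\exp)_A^{*}(\operatorname{grad}f(e^A))$ for differentiable $f$. The step-update map induced by the exponential parametrization is $$\widehat r_A:T_{e^A}G\to G,\qquad \widehat r_A(V)=\exp\bigl(A+(\mathrm d\exp)_A^{*}(V)\bigr),$$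 so that $\widehat r_A(-\eta\operatorname{grad} f(e^A))=\exp\bigl(A-\eta\nabla(f\circ\exp)(A)\bigr)$ is one step of gradient descent with learning rate $\eta$ for $f\circ\exp$ on $\mathfrak g$. If $G=SO(n)$ with $n>2$, or $G=U(n)$ with $n>1$, then the step-update map is not a retraction, whichever logarithms are used to define it. That is: 1. it is not true that for every $A\in\mathfrak g$ the map $\widehat r_A$ satisfies the two retraction conditions at the point $B=e^A$; 2. for every map $\log:G\to\mathfrak g$ with $\exp(\log B)=B$ for all $B\in\exp(\mathfrak g)$, the family $r_B(V)=\exp\bigl(\log B+(\mathrm d\exp)_{\log B}^{*}(V)\bigr)$, $B\in G$, $V\in T_BG$, is not a retraction on $G$. -/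

import Mathlib

open scoped Matrix Matrix.Norms.Frobenius RealInnerProductSpace

/-- The real inner product `⟪X, Y⟫ = Re tr (Xᴴ Y)` on `n × n` matrices over `𝕜 = ℝ` or `ℂ`, whose norm is
the Frobenius norm. For `𝕜 = ℝ` it is `tr (Xᵀ Y)`. -/
noncomputable instance matrixInnerProductSpace {𝕜 : Type*} [RCLike 𝕜] (n : ℕ) :
    InnerProductSpace ℝ (Matrix (Fin n) (Fin n) 𝕜) where
  toNormedSpace := Matrix.frobeniusNormedSpace
  inner X Y := RCLike.re (Xᴴ * Y).trace
  norm_sq_eq_re_inner X := by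
    have h : (Xᴴ * X).trace = ∑ j, ∑ i, star (X i j) * X i j := by
      simp [Matrix.trace, Matrix.mul_apply]
    rw [Matrix.frobenius_norm_def, ← Real.sqrt_eq_rpow, Real.sq_sqrt (by positivity), h,
      Finset.sum_comm, RCLike.re_to_real, map_sum]
    refine Finset.sum_congr rfl fun i _ => ?_
    rw [map_sum]
    refine Finset.sum_congr rfl fun j _ => ?_
    rw [RCLike.star_def, RCLike.conj_mul, ← RCLike.ofReal_pow, RCLike.ofReal_re, Real.rpow_two]
  conj_inner_symm X Y := by
    have h : (Xᴴ * Y).trace = star (Yᴴ * X).trace := by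
      rw [← Matrix.trace_conjTranspose, Matrix.conjTranspose_mul, Matrix.conjTranspose_conjTranspose]
    simp [h]
  add_left X Y Z := by
    simp [Matrix.conjTranspose_add, add_mul]
  smul_left X Y r := by
    simp [Matrix.conjTranspose_smul, RCLike.smul_re]

namespace ExpParam

/-- The Lie algebra of skew-adjoint matrices `{A | Aᴴ = -A}`: it is `𝔰𝔬(n)` for `𝕜 = ℝ` and `𝔲(n)` for
`𝕜 = ℂ`. It carries the inner product `Re tr (Xᴴ Y)` of the ambient matrix space. -/
noncomputable abbrev skew (𝕜 : Type*) [RCLike 𝕜] (n : ℕ) : Submodule ℝ (Matrix (Fin n) (Fin n) 𝕜) :=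
  skewAdjoint.submodule ℝ (Matrix (Fin n) (Fin n) 𝕜)

/-- The tangent space `{X | Bᴴ X + Xᴴ B = 0}` of `SO(n)` (for `𝕜 = ℝ`) or `U(n)` (for `𝕜 = ℂ`) at a point
`B`, seen inside the space of all matrices. -/
def tangent {𝕜 : Type*} [RCLike 𝕜] {n : ℕ} (B : Matrix (Fin n) (Fin n) 𝕜) :
    Submodule ℝ (Matrix (Fin n) (Fin n) 𝕜) where
  carrier := {X | Bᴴ * X + Xᴴ * B = 0}
  zero_mem' := by simp
  add_mem' := by
    intro X Y hX hY
    simp only [Set.mem_ofPred_eq] at hX hY ⊢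
    rw [Matrix.conjTranspose_add, mul_add, add_mul]
    calc _ = (Bᴴ * X + Xᴴ * B) + (Bᴴ * Y + Yᴴ * B) := by abel
      _ = 0 := by rw [hX, hY, add_zero]
  smul_mem' := by
    intro c X hX
    simp only [Set.mem_ofPred_eq] at hX ⊢
    rw [Matrix.conjTranspose_smul, mul_smul_comm, smul_mul_assoc, star_trivial, ← smul_add, hX,
      smul_zero]

/-- `SO(n)`. -/
abbrev SO (n : ℕ) : Submonoid (Matrix (Fin n) (Fin n) ℝ) :=
  Matrix.specialOrthogonalGroup (Fin n) ℝ

/-- `U(n)`. -/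
abbrev U (n : ℕ) : Submonoid (Matrix (Fin n) (Fin n) ℂ) :=
  Matrix.unitaryGroup (Fin n) ℂ

/-- `r : T_B G → G` satisfies the retraction conditions at the point `B` of `G`, where `G` is `SO(n)` or `U(n)`:
`r 0 = B`, and `r` is differentiable at `0` with differential the identity of `T_B G` (the differential
is taken in the ambient matrix space, where the identity of `T_B G` is the inclusion). -/
def IsRetractionAt {𝕜 : Type*} [RCLike 𝕜] {n : ℕ} {G : Submonoid (Matrix (Fin n) (Fin n) 𝕜)} (B : G)
    (r : tangent (B : Matrix (Fin n) (Fin n) 𝕜) → G) : Prop :=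
  r 0 = B ∧
    HasFDerivAt (fun V => (r V : Matrix (Fin n) (Fin n) 𝕜))
      (tangent (B : Matrix (Fin n) (Fin n) 𝕜)).subtypeL 0

/-- A family `r_B : T_B G → G`, `B ∈ G`, is a retraction for `G`. -/
def IsRetraction {𝕜 : Type*} [RCLike 𝕜] {n : ℕ} (G : Submonoid (Matrix (Fin n) (Fin n) 𝕜))
    (r : ∀ B : G, tangent (B : Matrix (Fin n) (Fin n) 𝕜) → G) : Prop :=
  ∀ B : G, IsRetractionAt B (r B)

/-- The differential at `A` of the matrix exponential on the Lie algebra. -/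
noncomputable def dexp {𝕜 : Type*} [RCLike 𝕜] {n : ℕ} (A : skew 𝕜 n) :
    skew 𝕜 n →L[ℝ] Matrix (Fin n) (Fin n) 𝕜 :=
  fderiv ℝ (fun X : skew 𝕜 n => NormedSpace.exp (X : Matrix (Fin n) (Fin n) 𝕜)) A

/-- The adjoint `(d exp)_A^*` of the differential of the exponential with respect to `Re tr (Xᴴ Y)`. If `V`
is the Riemannian gradient of `f` at `exp A`, then `dexpAdj A V` is the gradient of `f ∘ exp` at `A`, see
`gradient_comp_exp` below. As `dexp A` takes its values in the tangent space at `exp A`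
(see `dexp_mem_tangent`), restricting `dexpAdj A` to that tangent space gives the adjoint of `dexp A`
as a map from the Lie algebra to the tangent space. -/
noncomputable def dexpAdj {𝕜 : Type*} [RCLike 𝕜] {n : ℕ} (A : skew 𝕜 n) :
    Matrix (Fin n) (Fin n) 𝕜 →L[ℝ] skew 𝕜 n :=
  ContinuousLinearMap.adjoint (dexp A)

theorem inner_dexpAdj_left {𝕜 : Type*} [RCLike 𝕜] {n : ℕ} (A Y : skew 𝕜 n)
    (V : Matrix (Fin n) (Fin n) 𝕜) : ⟪dexpAdj A V, Y⟫ = ⟪V, dexp A Y⟫ :=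
  ContinuousLinearMap.adjoint_inner_left (dexp A) Y V

theorem exp_mem_unitaryGroup {𝕜 : Type*} [RCLike 𝕜] {n : ℕ} (A : skew 𝕜 n) :
    NormedSpace.exp (A : Matrix (Fin n) (Fin n) 𝕜) ∈ Matrix.unitaryGroup (Fin n) 𝕜 := by
  have h : (A : Matrix (Fin n) (Fin n) 𝕜) ∈ skewAdjoint (Matrix (Fin n) (Fin n) 𝕜) := A.2
  have h' := (skewAdjoint.mem_iff).1 h
  have e : star (NormedSpace.exp (A : Matrix (Fin n) (Fin n) 𝕜)) =
      NormedSpace.exp (-(A : Matrix (Fin n) (Fin n) 𝕜)) := by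
    rw [← h', Matrix.star_eq_conjTranspose, Matrix.star_eq_conjTranspose, Matrix.exp_conjTranspose]
  rw [Matrix.mem_unitaryGroup_iff', e, Matrix.exp_neg]
  exact Matrix.nonsing_inv_mul _ ((Matrix.isUnit_iff_isUnit_det _).1 (Matrix.isUnit_exp _))

theorem exp_mem_SO {n : ℕ} (A : skew ℝ n) :
    NormedSpace.exp (A : Matrix (Fin n) (Fin n) ℝ) ∈ SO n := by
  rw [Matrix.mem_specialOrthogonalGroup_iff]
  refine ⟨exp_mem_unitaryGroup A, ?_⟩
  have hm := exp_mem_unitaryGroup ((1 / 2 : ℝ) • A)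
  have hsq : NormedSpace.exp (A : Matrix (Fin n) (Fin n) ℝ) =
      NormedSpace.exp (((1 / 2 : ℝ) • A : skew ℝ n) : Matrix (Fin n) (Fin n) ℝ) ^ 2 := by
    rw [← Matrix.exp_nsmul]
    congr 1
    rw [Submodule.coe_smul, ← Nat.cast_smul_eq_nsmul ℝ, smul_smul]
    norm_num
  have hd := congrArg Matrix.det (Matrix.mem_unitaryGroup_iff.1 hm)
  rw [Matrix.det_mul, Matrix.star_eq_conjTranspose, Matrix.det_conjTranspose, Matrix.det_one,
    star_trivial] at hd
  rw [hsq, Matrix.det_pow, pow_two, hd]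

theorem exp_mem_U {n : ℕ} (A : skew ℂ n) :
    NormedSpace.exp (A : Matrix (Fin n) (Fin n) ℂ) ∈ U n :=
  exp_mem_unitaryGroup A

/-- The exponential map from `𝔰𝔬(n)` to `SO(n)`. -/
noncomputable def expSO {n : ℕ} (A : skew ℝ n) : SO n := ⟨NormedSpace.exp A.1, exp_mem_SO A⟩

/-- The exponential map from `𝔲(n)` to `U(n)`. -/
noncomputable def expU {n : ℕ} (A : skew ℂ n) : U n := ⟨NormedSpace.exp A.1, exp_mem_U A⟩

/-- The step-update map of `SO(n)` at `exp A`, computed through the logarithm `A`: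
`V ↦ exp (A + (d exp)_A^* V)`. With `V = -η grad f(exp A)` this is `exp (A - η ∇(f ∘ exp)(A))`, one step of
gradient descent for `f ∘ exp`. -/
noncomputable def stepSO {n : ℕ} (A : skew ℝ n) (V : Matrix (Fin n) (Fin n) ℝ) : SO n :=
  expSO (A + dexpAdj A V)

/-- The step-update map of `U(n)` at `exp A`, computed through the logarithm `A`. -/
noncomputable def stepU {n : ℕ} (A : skew ℂ n) (V : Matrix (Fin n) (Fin n) ℂ) : U n :=
  expU (A + dexpAdj A V)

/-- `log` chooses a logarithm for every point in the image of `e`; nothing is asked of it elsewhere. -/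
def IsLogarithm {α β : Type*} (e : α → β) (log : β → α) : Prop :=
  ∀ A : α, e (log (e A)) = e A

theorem differentiable_exp {𝕜 : Type*} [RCLike 𝕜] {n : ℕ} :
    Differentiable ℝ
      (fun X : skew 𝕜 n => NormedSpace.exp (X : Matrix (Fin n) (Fin n) 𝕜)) := by
  intro A
  have h : AnalyticAt ℝ (NormedSpace.exp : Matrix (Fin n) (Fin n) 𝕜 → _) A.1 :=
    NormedSpace.exp_analytic (𝕂 := ℝ) A.1
  exact h.differentiableAt.comp A (skew 𝕜 n).subtypeL.differentiableAt

theorem dexp_mem_tangent {𝕜 : Type*} [RCLike 𝕜] {n : ℕ} (A X : skew 𝕜 n) :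
    dexp A X ∈ tangent (NormedSpace.exp (A : Matrix (Fin n) (Fin n) 𝕜)) := by
  have hd : HasFDerivAt (fun X : skew 𝕜 n => NormedSpace.exp (X : Matrix (Fin n) (Fin n) 𝕜))
    (dexp A) A := (differentiable_exp A).hasFDerivAt
  have h := hd.star.mul' hd
  have hc : (fun X : skew 𝕜 n => star (NormedSpace.exp (X : Matrix (Fin n) (Fin n) 𝕜)) *
      NormedSpace.exp (X : Matrix (Fin n) (Fin n) 𝕜)) = fun _ => 1 := by
    funext Y
    exact Matrix.mem_unitaryGroup_iff'.1 (exp_mem_unitaryGroup Y)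
  have h2 := h.unique (by
    have := hasFDerivAt_const (𝕜 := ℝ) (1 : Matrix (Fin n) (Fin n) 𝕜) A
    rw [← hc] at this; exact this)
  have h3 := DFunLike.congr_fun h2 X
  exact h3

/-- The step-update map is gradient descent in the Lie algebra: `(d exp)_A^*` sends the Riemannian gradient
of `f` at `exp A` (the tangent component of the ambient gradient) to the gradient of `f ∘ exp` at `A`. -/
theorem gradient_comp_exp {𝕜 : Type*} [RCLike 𝕜] {n : ℕ} (f : Matrix (Fin n) (Fin n) 𝕜 → ℝ)
    (A : skew 𝕜 n) (hf : DifferentiableAt ℝ f (NormedSpace.exp A.1)) :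
    dexpAdj A ((tangent (NormedSpace.exp A.1)).starProjection (gradient f (NormedSpace.exp A.1))) =
      gradient (fun X : skew 𝕜 n => f (NormedSpace.exp X.1)) A := by
  refine ext_inner_right ℝ fun Y => ?_
  have hc : HasFDerivAt (fun X : skew 𝕜 n => f (NormedSpace.exp X.1))
      ((fderiv ℝ f (NormedSpace.exp A.1)).comp (dexp A)) A :=
    HasFDerivAt.comp A hf.hasFDerivAt (differentiable_exp A).hasFDerivAt
  have h1 : ⟪gradient (fun X : skew 𝕜 n => f (NormedSpace.exp X.1)) A, Y⟫ =
      fderiv ℝ f (NormedSpace.exp A.1) (dexp A Y) :=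
    (InnerProductSpace.toDual_symm_apply).trans (DFunLike.congr_fun hc.fderiv Y)
  have h2 : ⟪gradient f (NormedSpace.exp A.1), dexp A Y⟫ =
      fderiv ℝ f (NormedSpace.exp A.1) (dexp A Y) := InnerProductSpace.toDual_symm_apply
  rw [h1, ← h2, inner_dexpAdj_left, Submodule.inner_starProjection_left_eq_right,
    Submodule.starProjection_eq_self_iff.2 (dexp_mem_tangent A Y)]

end ExpParam

namespace ExpParam

open NormedSpace

section

variable {𝕜 : Type*} [RCLike 𝕜] {n : ℕ}

/-! By the chain rule the step map through `A` has the identity as differential only if `dexp A`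
composed with its adjoint is the identity on the tangent space. Equal dimensions then make `dexp A`
an isometry (`norm_dexp_of_dexp_dexpAdj`). On a commutator `[Y, A]` its value is `Y e^A - e^A Y`
(`dexp_commutator`), so `‖[A, Y]‖ = ‖Y - e^A Y e^{-A}‖`. The left side is the length of the arc `t ↦
e^{tA} Y e^{-tA}`, `0 ≤ t ≤ 1`, the right side its chord. The arc lies on a sphere, so equality
forces `[A, Y] = 0` (`commute_of_le_chord`), and `A` is central. The dimension bounds provide
noncentral elements. For arbitrary logarithms, centrality of `log (e^{tA})` passes to `e^{tA}` for
every `t`, and hence to `A`. -/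

theorem inner_matrix_def (X Y : Matrix (Fin n) (Fin n) 𝕜) :
    ⟪X, Y⟫ = RCLike.re (Xᴴ * Y).trace := rfl

theorem norm_eq_of_trace_eq {X Y : Matrix (Fin n) (Fin n) 𝕜}
    (h : (Xᴴ * X).trace = (Yᴴ * Y).trace) : ‖X‖ = ‖Y‖ := by
  have h2 : ‖X‖ ^ 2 = ‖Y‖ ^ 2 := by
    rw [← real_inner_self_eq_norm_sq, ← real_inner_self_eq_norm_sq, inner_matrix_def,
      inner_matrix_def, h]
  exact (sq_eq_sq₀ (norm_nonneg _) (norm_nonneg _)).1 h2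

/-- The Frobenius norm is invariant under left multiplication by unitary matrices. -/
theorem norm_unitary_mul {B : Matrix (Fin n) (Fin n) 𝕜} (hB : Bᴴ * B = 1)
    (X : Matrix (Fin n) (Fin n) 𝕜) : ‖B * X‖ = ‖X‖ := by
  apply norm_eq_of_trace_eq
  rw [Matrix.conjTranspose_mul, Matrix.mul_assoc, ← Matrix.mul_assoc Bᴴ, hB, Matrix.one_mul]

/-- The Frobenius norm is invariant under right multiplication by unitary matrices. -/
theorem norm_mul_unitary {B : Matrix (Fin n) (Fin n) 𝕜} (hB : B * Bᴴ = 1)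
    (X : Matrix (Fin n) (Fin n) 𝕜) : ‖X * B‖ = ‖X‖ := by
  apply norm_eq_of_trace_eq
  rw [Matrix.conjTranspose_mul, Matrix.mul_assoc, Matrix.trace_mul_comm, Matrix.mul_assoc,
    Matrix.mul_assoc, hB, Matrix.mul_one]

theorem skew_conjTranspose (A : skew 𝕜 n) :
    (A : Matrix (Fin n) (Fin n) 𝕜)ᴴ = -(A : Matrix (Fin n) (Fin n) 𝕜) :=
  skewAdjoint.mem_iff.1 A.2

theorem mem_skew_iff {A : Matrix (Fin n) (Fin n) 𝕜} : A ∈ skew 𝕜 n ↔ Aᴴ = -A :=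
  skewAdjoint.mem_iff

theorem exp_conjTranspose_mul (A : skew 𝕜 n) :
    (exp (A : Matrix (Fin n) (Fin n) 𝕜))ᴴ * exp (A : Matrix (Fin n) (Fin n) 𝕜) = 1 :=
  Matrix.mem_unitaryGroup_iff'.1 (exp_mem_unitaryGroup A)

theorem exp_mul_conjTranspose (A : skew 𝕜 n) :
    exp (A : Matrix (Fin n) (Fin n) 𝕜) * (exp (A : Matrix (Fin n) (Fin n) 𝕜))ᴴ = 1 :=
  Matrix.mem_unitaryGroup_iff.1 (exp_mem_unitaryGroup A)

theorem exp_neg_mul_exp (A : Matrix (Fin n) (Fin n) 𝕜) : exp (-A) * exp A = 1 := by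
  rw [Matrix.exp_neg]
  exact Matrix.nonsing_inv_mul _ ((Matrix.isUnit_iff_isUnit_det _).1 (Matrix.isUnit_exp A))

theorem exp_mul_exp_neg (A : Matrix (Fin n) (Fin n) 𝕜) : exp A * exp (-A) = 1 := by
  simpa using exp_neg_mul_exp (-A)

theorem exp_neg_skew (A : skew 𝕜 n) :
    exp (-(A : Matrix (Fin n) (Fin n) 𝕜)) = (exp (A : Matrix (Fin n) (Fin n) 𝕜))ᴴ := by
  rw [← skew_conjTranspose, Matrix.exp_conjTranspose]

/-! ### Conjugation orbits: chord against arc -/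

/-- The curve `t ↦ exp (t A) Y exp (-t A)`. -/
noncomputable def conjCurve (A Y : Matrix (Fin n) (Fin n) 𝕜) (t : ℝ) : Matrix (Fin n) (Fin n) 𝕜 :=
  exp (t • A) * Y * exp (-(t • A))

theorem conjCurve_zero (A Y : Matrix (Fin n) (Fin n) 𝕜) : conjCurve A Y 0 = Y := by
  simp [conjCurve]

/-- The velocity is again a conjugation curve, now through the commutator; for skew `A` the speed is
therefore constant. -/
theorem hasDerivAt_conjCurve (A Y : Matrix (Fin n) (Fin n) 𝕜) (t : ℝ) :
    HasDerivAt (conjCurve A Y) (conjCurve A (A * Y - Y * A) t) t := by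
  have h1 : HasDerivAt (fun u : ℝ => exp (u • A)) (exp (t • A) * A) t :=
    hasDerivAt_exp_smul_const A t
  have h2 : HasDerivAt (fun u : ℝ => exp (u • -A)) (-A * exp (t • -A)) t :=
    hasDerivAt_exp_smul_const' (-A) t
  have h := (h1.mul_const Y).mul h2
  simp only [smul_neg] at h
  refine h.congr_deriv ?_
  simp only [conjCurve]
  noncomm_ring

theorem norm_conjCurve (A : skew 𝕜 n) (Y : Matrix (Fin n) (Fin n) 𝕜) (t : ℝ) :
    ‖conjCurve (A : Matrix (Fin n) (Fin n) 𝕜) Y t‖ = ‖Y‖ := by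
  have h := exp_neg_skew (t • A)
  rw [Submodule.coe_smul] at h
  rw [conjCurve, h, norm_mul_unitary, norm_unitary_mul]
  · exact exp_conjTranspose_mul (t • A)
  · rw [Matrix.conjTranspose_conjTranspose]
    exact exp_conjTranspose_mul (t • A)

theorem dist_conjCurve_le (A : skew 𝕜 n) (Y : Matrix (Fin n) (Fin n) 𝕜) (s t : ℝ) :
    dist (conjCurve (A : Matrix (Fin n) (Fin n) 𝕜) Y s) (conjCurve (A : Matrix (Fin n) (Fin n) 𝕜) Y t)
      ≤ ‖(A : Matrix (Fin n) (Fin n) 𝕜) * Y - Y * A‖ * |s - t| := by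
  rw [dist_eq_norm, ← Real.norm_eq_abs]
  refine convex_univ.norm_image_sub_le_of_norm_hasDerivWithin_le
    (fun x _ => (hasDerivAt_conjCurve _ Y x).hasDerivWithinAt) (fun x _ => ?_)
    (Set.mem_univ _) (Set.mem_univ _)
  exact (norm_conjCurve A _ x).le

/-- On the curve `t ↦ exp (t A) Y exp (-t A)` the chord is shorter than the arc unless `A` and
`Y` commute. -/
theorem commute_of_le_chord (A : skew 𝕜 n) (Y : Matrix (Fin n) (Fin n) 𝕜)
    (h : ‖(A : Matrix (Fin n) (Fin n) 𝕜) * Y - Y * A‖ ≤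
      dist (conjCurve (A : Matrix (Fin n) (Fin n) 𝕜) Y 0)
        (conjCurve (A : Matrix (Fin n) (Fin n) 𝕜) Y 1)) :
    (A : Matrix (Fin n) (Fin n) 𝕜) * Y = Y * A := by
  set c := conjCurve (A : Matrix (Fin n) (Fin n) 𝕜) Y
  set m := ‖(A : Matrix (Fin n) (Fin n) 𝕜) * Y - Y * A‖
  have h1 : dist (c 0) (c 2⁻¹) ≤ m * 2⁻¹ := by
    refine (dist_conjCurve_le A Y 0 2⁻¹).trans_eq ?_
    norm_num [m]
  have h2 : dist (c 2⁻¹) (c 1) ≤ m * 2⁻¹ := by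
    refine (dist_conjCurve_le A Y 2⁻¹ 1).trans_eq ?_
    norm_num [m, abs_of_neg]
  have h3 := dist_triangle (c 0) (c 2⁻¹) (c 1)
  -- Both half arcs have length `m / 2` while the chord is at least `m`; strict convexity of the
  -- norm puts `c 2⁻¹` at the midpoint of the chord.
  have hm : c 2⁻¹ = midpoint ℝ (c 0) (c 1) :=
    eq_midpoint_of_dist_eq_half (by linarith) (by linarith)
  have n0 : ‖c 0‖ = ‖Y‖ := norm_conjCurve A Y 0
  have n1 : ‖c 1‖ = ‖Y‖ := norm_conjCurve A Y 1
  have nh : ‖c 2⁻¹‖ = ‖Y‖ := norm_conjCurve A Y 2⁻¹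
  -- The midpoint has the same norm as the endpoints, which the parallelogram law allows only for a
  -- degenerate chord.
  have hc : c 0 = c 1 := by
    have hp := parallelogram_law_with_norm ℝ (c 0) (c 1)
    rw [midpoint_eq_smul_add] at hm
    have hs : ‖c 0 + c 1‖ = 2 * ‖Y‖ := by
      rw [← nh, hm, norm_smul]
      norm_num
      ring
    rw [hs, n0, n1] at hp
    have : ‖c 0 - c 1‖ = 0 := by nlinarith [norm_nonneg (c 0 - c 1)]
    exact sub_eq_zero.1 (norm_eq_zero.1 this)
  rw [hc, dist_self] at h
  exact sub_eq_zero.1 (norm_eq_zero.1 (le_antisymm h (norm_nonneg _)))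

/-! ### The differential of the exponential: commutators and isometry -/

theorem commutator_mem_skew (A Y : skew 𝕜 n) :
    (A : Matrix (Fin n) (Fin n) 𝕜) * Y - Y * A ∈ skew 𝕜 n := by
  rw [mem_skew_iff, Matrix.conjTranspose_sub, Matrix.conjTranspose_mul, Matrix.conjTranspose_mul,
    skew_conjTranspose, skew_conjTranspose]
  noncomm_ring

/-- The differential of the exponential on commutators. -/
theorem dexp_commutator (A Y : skew 𝕜 n) :
    dexp A ⟨(Y : Matrix (Fin n) (Fin n) 𝕜) * A - A * Y, commutator_mem_skew Y A⟩ =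
      (Y : Matrix (Fin n) (Fin n) 𝕜) * exp (A : Matrix (Fin n) (Fin n) 𝕜) - exp A.1 * Y := by
  have hE : HasFDerivAt (exp : Matrix (Fin n) (Fin n) 𝕜 → _) (fderiv ℝ exp A.1) A.1 :=
    (exp_analytic (𝕂 := ℝ) A.1).differentiableAt.hasFDerivAt
  have hD : dexp A = (fderiv ℝ exp A.1).comp (skew 𝕜 n).subtypeL :=
    (hE.comp A (skew 𝕜 n).subtypeL.hasFDerivAt).fderiv
  have hγ := hasDerivAt_conjCurve (Y : Matrix (Fin n) (Fin n) 𝕜) A 0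
  rw [conjCurve_zero] at hγ
  -- Both sides of `exp (e^{tY} A e^{-tY}) = e^{tY} e^A e^{-tY}` are differentiated at `t = 0`.
  have h1 := HasFDerivAt.comp_hasDerivAt_of_eq (0 : ℝ) hE hγ (conjCurve_zero _ _).symm
  have he : (exp ∘ conjCurve (Y : Matrix (Fin n) (Fin n) 𝕜) A) =
      conjCurve (Y : Matrix (Fin n) (Fin n) 𝕜) (exp A.1) := by
    funext t
    simp only [Function.comp, conjCurve, Matrix.exp_neg]
    exact Matrix.exp_conj _ _ (Matrix.isUnit_exp _)
  rw [he] at h1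
  have h2 := hasDerivAt_conjCurve (Y : Matrix (Fin n) (Fin n) 𝕜) (exp A.1) 0
  rw [conjCurve_zero] at h2
  rw [hD]
  exact h1.unique h2

/-- If `d exp` at `A` composed with its adjoint is the identity of the tangent space at `exp A`, then
`d exp` at `A` is isometric. -/
theorem norm_dexp_of_dexp_dexpAdj (A : skew 𝕜 n)
    (h : ∀ V ∈ tangent (exp (A : Matrix (Fin n) (Fin n) 𝕜)), dexp A (dexpAdj A V) = V)
    (X : skew 𝕜 n) : ‖dexp A X‖ = ‖X‖ := by
  set B := exp (A : Matrix (Fin n) (Fin n) 𝕜)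
  have hB : Bᴴ * B = 1 := exp_conjTranspose_mul A
  have hmem (X : skew 𝕜 n) : Bᴴ * dexp A X ∈ skew 𝕜 n := by
    rw [mem_skew_iff, Matrix.conjTranspose_mul, Matrix.conjTranspose_conjTranspose]
    exact eq_neg_of_add_eq_zero_right (dexp_mem_tangent A X)
  -- Left translation by `Bᴴ` turns `dexp A` into an endomorphism of a finite-dimensional space. The
  -- hypothesis makes it surjective, hence injective, so `dexpAdj A` is a left inverse of `dexp A`
  -- as well.
  let E : skew 𝕜 n →ₗ[ℝ] skew 𝕜 n :=
    ((LinearMap.mulLeft ℝ Bᴴ).comp (dexp A).toLinearMap).codRestrict _ hmem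
  have hE (X : skew 𝕜 n) : ((E X : skew 𝕜 n) : Matrix (Fin n) (Fin n) 𝕜) = Bᴴ * dexp A X := rfl
  have hsurj : Function.Surjective E := by
    intro Z
    have hV : B * (Z : Matrix (Fin n) (Fin n) 𝕜) ∈ tangent B := by
      change Bᴴ * (B * (Z : Matrix (Fin n) (Fin n) 𝕜)) +
        (B * (Z : Matrix (Fin n) (Fin n) 𝕜))ᴴ * B = 0
      rw [Matrix.conjTranspose_mul, skew_conjTranspose, ← Matrix.mul_assoc, Matrix.mul_assoc _ Bᴴ,
        hB, Matrix.one_mul, Matrix.mul_one, add_neg_cancel]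
    refine ⟨dexpAdj A (B * (Z : Matrix (Fin n) (Fin n) 𝕜)), Subtype.ext ?_⟩
    rw [hE, h _ hV, ← Matrix.mul_assoc, hB, Matrix.one_mul]
  have hinj : Function.Injective E := LinearMap.injective_iff_surjective.2 hsurj
  have hX : dexpAdj A (dexp A X) = X := by
    apply hinj
    apply Subtype.ext
    rw [hE, hE, h _ (dexp_mem_tangent A X)]
  have h2 : ‖dexp A X‖ ^ 2 = ‖X‖ ^ 2 := by
    rw [← real_inner_self_eq_norm_sq, ← inner_dexpAdj_left, hX, real_inner_self_eq_norm_sq]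
  exact (sq_eq_sq₀ (norm_nonneg _) (norm_nonneg _)).1 h2

/-- If the step-update map computed through `A` has the identity as differential, then `A` is central in
the Lie algebra. -/
theorem mul_comm_of_hasFDerivAt_step {A : skew 𝕜 n} {B : Matrix (Fin n) (Fin n) 𝕜}
    (hB : exp (A : Matrix (Fin n) (Fin n) 𝕜) = B)
    (h : HasFDerivAt (fun V : tangent B =>
      exp ((A + dexpAdj A (V : Matrix (Fin n) (Fin n) 𝕜) : skew 𝕜 n) : Matrix (Fin n) (Fin n) 𝕜))
      (tangent B).subtypeL 0) (Y : skew 𝕜 n) :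
    (A : Matrix (Fin n) (Fin n) 𝕜) * Y = Y * A := by
  subst hB
  set B := exp (A : Matrix (Fin n) (Fin n) 𝕜)
  have hstep : HasFDerivAt (fun V : tangent B => A + dexpAdj A (V : Matrix (Fin n) (Fin n) 𝕜))
      ((dexpAdj A).comp (tangent B).subtypeL) 0 :=
    ((dexpAdj A).comp (tangent B).subtypeL).hasFDerivAt.const_add A
  have hd : HasFDerivAt (fun X : skew 𝕜 n => exp (X : Matrix (Fin n) (Fin n) 𝕜)) (dexp A) A :=
    (differentiable_exp A).hasFDerivAt
  have hA : A = A + dexpAdj A ((0 : tangent B) : Matrix (Fin n) (Fin n) 𝕜) := by simp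
  have hd' : HasFDerivAt (fun X : skew 𝕜 n => exp (X : Matrix (Fin n) (Fin n) 𝕜)) (dexp A)
      (A + dexpAdj A ((0 : tangent B) : Matrix (Fin n) (Fin n) 𝕜)) := hA ▸ hd
  have hcomp := HasFDerivAt.comp (0 : tangent B) hd' hstep
  have hu := hcomp.unique h
  have hDD (V) (hV : V ∈ tangent B) : dexp A (dexpAdj A V) = V :=
    DFunLike.congr_fun hu (⟨V, hV⟩ : tangent B)
  have hiso := norm_dexp_of_dexp_dexpAdj A hDD
    ⟨(Y : Matrix (Fin n) (Fin n) 𝕜) * A - A * Y, commutator_mem_skew Y A⟩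
  rw [dexp_commutator, Submodule.coe_norm] at hiso
  apply commute_of_le_chord
  rw [norm_sub_rev, ← hiso, conjCurve_zero, dist_eq_norm]
  apply le_of_eq
  have hinv : exp (-(A : Matrix (Fin n) (Fin n) 𝕜)) * exp (A : Matrix (Fin n) (Fin n) 𝕜) = 1 :=
    exp_neg_mul_exp _
  -- Right multiplication by the unitary `e^A` turns the chord `Y - e^A Y e^{-A}` into `Y e^A - e^A
  -- Y`.
  rw [← norm_mul_unitary (exp_mul_conjTranspose A)
    ((Y : Matrix (Fin n) (Fin n) 𝕜) - conjCurve (A : Matrix (Fin n) (Fin n) 𝕜) Y 1)]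
  rw [conjCurve, one_smul, sub_mul, Matrix.mul_assoc _ _ (exp (A : Matrix (Fin n) (Fin n) 𝕜)), hinv,
    Matrix.mul_one]

/-- The conjugation curve through `Y` is constant, so its velocity `A * Y - Y * A` at `0` vanishes.
All `t` are needed: a single exponential may be central without `A` being so. -/
theorem mul_comm_of_exp_smul {A Y : Matrix (Fin n) (Fin n) 𝕜}
    (h : ∀ t : ℝ, exp (t • A) * Y = Y * exp (t • A)) : A * Y = Y * A := by
  have hc : conjCurve A Y = fun _ => Y := by
    funext t
    rw [conjCurve, h, Matrix.mul_assoc, exp_mul_exp_neg, Matrix.mul_one]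
  have h1 := hasDerivAt_conjCurve A Y 0
  rw [conjCurve_zero, hc] at h1
  exact sub_eq_zero.1 (h1.unique (hasDerivAt_const 0 Y))

theorem exp_mul_comm {A Y : Matrix (Fin n) (Fin n) 𝕜} (h : A * Y = Y * A) :
    exp A * Y = Y * exp A :=
  (Commute.exp_left (show Commute A Y from h)).eq

end

/-! ### Noncentral elements and the conclusion -/

theorem exists_skew_real_not_commute {n : ℕ} (hn : 2 < n) :
    ∃ A Y : skew ℝ n, (A : Matrix (Fin n) (Fin n) ℝ) * Y ≠ Y * A := by
  let i : Fin n := ⟨0, by omega⟩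
  let j : Fin n := ⟨1, by omega⟩
  let k : Fin n := ⟨2, by omega⟩
  have hij : i ≠ j := by simp [i, j]
  have hik : i ≠ k := by simp [i, k]
  have hjk : j ≠ k := by simp [j, k]
  refine ⟨⟨Matrix.single i j 1 - Matrix.single j i 1, ?_⟩,
    ⟨Matrix.single j k 1 - Matrix.single k j 1, ?_⟩, fun h => ?_⟩
  · rw [mem_skew_iff]
    simp
  · rw [mem_skew_iff]
    simp
  -- Infinitesimal rotations in two planes sharing the axis `j`: the `(i, k)` entry is `1` in one
  -- product and `0` in the other.
  · have h1 := congrFun (congrFun h i) k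
    simp [mul_sub, sub_mul, hij, hik, hjk, hij.symm, hik.symm, hjk.symm] at h1

theorem exists_skew_complex_not_commute {n : ℕ} (hn : 1 < n) :
    ∃ A Y : skew ℂ n, (A : Matrix (Fin n) (Fin n) ℂ) * Y ≠ Y * A := by
  let i : Fin n := ⟨0, by omega⟩
  let j : Fin n := ⟨1, by omega⟩
  have hij : i ≠ j := by simp [i, j]
  refine ⟨⟨Matrix.single i i Complex.I, ?_⟩,
    ⟨Matrix.single i j 1 - Matrix.single j i 1, ?_⟩, fun h => ?_⟩
  · rw [mem_skew_iff]
    simp [← Matrix.single_neg]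
  · rw [mem_skew_iff]
    simp
  -- The `(i, j)` entry is `Complex.I` in one product and `0` in the other.
  · have h1 := congrFun (congrFun h i) j
    simp [hij, hij.symm] at h1

end ExpParam

theorem mainTheorem6 :
    (∀ n : ℕ, 2 < n →
      (¬ ∀ A : ExpParam.skew ℝ n,
          ExpParam.IsRetractionAt (ExpParam.expSO A) (fun V => ExpParam.stepSO A V.1)) ∧
      ∀ log : ExpParam.SO n → ExpParam.skew ℝ n, ExpParam.IsLogarithm ExpParam.expSO log →
        ¬ ExpParam.IsRetraction (ExpParam.SO n) (fun B V => ExpParam.stepSO (log B) V.1)) ∧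
    (∀ n : ℕ, 1 < n →
      (¬ ∀ A : ExpParam.skew ℂ n,
          ExpParam.IsRetractionAt (ExpParam.expU A) (fun V => ExpParam.stepU A V.1)) ∧
      ∀ log : ExpParam.U n → ExpParam.skew ℂ n, ExpParam.IsLogarithm ExpParam.expU log →
        ¬ ExpParam.IsRetraction (ExpParam.U n) (fun B V => ExpParam.stepU (log B) V.1)) := by
  refine ⟨fun n hn => ?_, fun n hn => ?_⟩
  · obtain ⟨A, Y, hAY⟩ := ExpParam.exists_skew_real_not_commute hn
    refine ⟨fun h => hAY (ExpParam.mul_comm_of_hasFDerivAt_step rfl (h A).2 Y), fun log hlog h => ?_⟩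
    refine hAY (ExpParam.mul_comm_of_exp_smul fun t => ?_)
    -- The chosen logarithm need not be `t • A`; only its exponential is known, so commutation is
    -- transferred to `exp (t • A)`.
    have he : NormedSpace.exp (log (ExpParam.expSO (t • A))).1 = NormedSpace.exp (t • A.1) :=
      congrArg Subtype.val (hlog (t • A))
    rw [← he]
    exact ExpParam.exp_mul_comm
      (ExpParam.mul_comm_of_hasFDerivAt_step he (h (ExpParam.expSO (t • A))).2 Y)
  · obtain ⟨A, Y, hAY⟩ := ExpParam.exists_skew_complex_not_commute hn
    refine ⟨fun h => hAY (ExpParam.mul_comm_of_hasFDerivAt_step rfl (h A).2 Y), fun log hlog h => ?_⟩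
    refine hAY (ExpParam.mul_comm_of_exp_smul fun t => ?_)
    have he : NormedSpace.exp (log (ExpParam.expU (t • A))).1 = NormedSpace.exp (t • A.1) :=
      congrArg Subtype.val (hlog (t • A))
    rw [← he]
    exact ExpParam.exp_mul_comm
      (ExpParam.mul_comm_of_hasFDerivAt_step he (h (ExpParam.expU (t • A))).2 Y)
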